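/- Let $d\ge 1$, let $\Omega\subset\mathbb{R}^d$ be open and bounded, and write $|E|$ for Lebesgue measure. For $A\subset\Omega$ measurable and $v\in L^\infty(A)$ let $m_v(q)=|\{x\in A: v(x)>q\}|$ be the distribution function of $v$ and let $v_*:[0,|A|]\to\mathbb{R}$ be its decreasing rearrangement: $v_*(s)=\inf\{q\in\mathbb{R}: m_v(q)\le s\}$ for $0<s<|A|$, $v_*(0)=\operatorname{ess\,sup}_A v$, $v_*(|A|)=\operatorname{ess\,inf}_A v$. For $u,b\in L^\infty(\Omega)$ the relative rearrangement of $b$ with respect to $u$ is $$b_{*u}=\frac{d}{ds}\left(\int_{\{u>u_*(s)\}} b(y)\,dy+\int_0^{s-|\{u>u_*(s)\}|}\big(b|_{\{u=u_*(s)\}}\big)_*(\sigma)\,d\sigma\right)\quad\text{on }(0,|\Omega|).$$ Let $\mathcal{K}\in L^\infty(\mathbb{R},\mathbb{R}_+)$ (with a fixed Borel representative), let $h>0$ and $\mathcal{K}_h(\xi)=\mathcal{K}(\xi/h)$, and let $w\in L^\infty(\Omega\times\Omega,\mathbb{R}_+)$ and $u\in L^\infty(\Omega)$ with $u\ge 0$.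 Put $$F_hu(x)=\frac{\int_\Omega \mathcal{K}_h(u(x)-u(y))\,w(x,y)\,u(y)\,dy}{\int_\Omega \mathcal{K}_h(u(x)-u(y))\,w(x,y)\,dy},\qquad F_h^*u(x)=\frac{\int_0^{|\Omega|}\mathcal{K}_h(u(x)-u_*(s))\,u_*(s)\,w(x,\cdot)_{*u}(s)\,ds}{\int_0^{|\Omega|}\mathcal{K}_h(u(x)-u_*(s))\,w(x,\cdot)_{*u}(s)\,ds}.$$ (i) For every $b\in L^\infty(\Omega)$ the function differentiated in the definition of $b_{*u}$ is Lipschitz on $(0,|\Omega|)$, so that $b_{*u}$ is defined almost everywhere and belongs to $L^\infty(0,|\Omega|)$; and for every bounded Borel function $f:\mathbb{R}\to\mathbb{R}$, both integrands being integrable, $$\int_\Omega f(u(y))\,b(y)\,dy=\int_0^{|\Omega|} f(u_*(s))\,b_{*u}(s)\,ds .$$ (ii) For a.e. $x\in\Omega$, $w(x,\cdot)\in L^\infty(\Omega)$. For a.e. $x\in\Omega$, moreover, the numerator of $F_hu(x)$ has an integrable integrand if and only if that of $F_h^*u(x)$ has one, and likewise for the denominators (all four integrands are integrable if the chosen representative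 of $\mathcal{K}$ is bounded everywhere); the numerators of $F_hu(x)$ and $F_h^*u(x)$ are equal, the denominators are equal, and therefore $F_h^*u(x)=F_hu(x)$. Here an integral with a non-integrable integrand and a quotient with denominator $0$ are both given the value $0$. -/

import Mathlib

open MeasureTheory Set
open scoped ENNReal NNReal

namespace NonlocalFilter

noncomputable section

/-- The distribution function `m_u(q) = |{x ∈ A : u(x) > q}|` of `u : A → ℝ`. -/
def distributionFun {α : Type*} [MeasureSpace α] (A : Set α) (u : α → ℝ) (q : ℝ) : ℝ :=
  volume.real {x | x ∈ A ∧ q < u x}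

/-- The decreasing rearrangement `u_*` on `[0, |A|]` of `u : A → ℝ`
(its values off `[0, |A|]` are irrelevant). -/
def decRearr {α : Type*} [MeasureSpace α] (A : Set α) (u : α → ℝ) (s : ℝ) : ℝ :=
  if s = 0 then essSup u (volume.restrict A)
  else if s = volume.real A then essInf u (volume.restrict A)
  else sInf {q : ℝ | distributionFun A u q ≤ s}

/-- The flat region `{x ∈ A : u(x) = q}`. -/
def levelSet {α : Type*} (A : Set α) (u : α → ℝ) (q : ℝ) : Set α :=
  {x | x ∈ A ∧ u x = q}

/-- The primitive of the relative rearrangement of `v` with respect to `u`: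
`s ↦ ∫_{u > u_*(s)} v + ∫_0^{s - |u > u_*(s)|} (v|_{u = u_*(s)})_*(σ) dσ`. -/
def relPrimitive {α : Type*} [MeasureSpace α] (A : Set α) (u v : α → ℝ) (s : ℝ) : ℝ :=
  (∫ x in {x | x ∈ A ∧ decRearr A u s < u x}, v x) +
    ∫ σ in (0 : ℝ)..(s - distributionFun A u (decRearr A u s)),
      decRearr (levelSet A u (decRearr A u s)) v σ

/-- The relative rearrangement `v_{*u}` of `v` with respect to `u`. -/
def relRearr {α : Type*} [MeasureSpace α] (A : Set α) (u v : α → ℝ) (s : ℝ) : ℝ :=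
  deriv (relPrimitive A u v) s

/-- The rescaled kernel `𝒦_h(ξ) = 𝒦(ξ / h)`. -/
def scaledKernel (K : ℝ → ℝ) (h ξ : ℝ) : ℝ := K (ξ / h)

/-- The integrand of the normalization factor `C(x)`. -/
def normIntegrand {α : Type*} (K : ℝ → ℝ) (h : ℝ) (w : α → α → ℝ) (u : α → ℝ) (x y : α) : ℝ :=
  scaledKernel K h (u x - u y) * w x y

/-- The integrand of the filter `F_h u(x)`, before normalization. -/
def filterIntegrand {α : Type*} (K : ℝ → ℝ) (h : ℝ) (w : α → α → ℝ) (u : α → ℝ) (x y : α) : ℝ :=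
  scaledKernel K h (u x - u y) * w x y * u y

/-- The nonlocal filter `F_h u(x)`. -/
def nonlocalFilter {α : Type*} [MeasureSpace α] (A : Set α) (K : ℝ → ℝ) (h : ℝ)
    (w : α → α → ℝ) (u : α → ℝ) (x : α) : ℝ :=
  1 / (∫ y in A, normIntegrand K h w u x y) * ∫ y in A, filterIntegrand K h w u x y

/-- The integrand of the denominator of `F_h^* u(x)`. -/
def normIntegrandStar {α : Type*} [MeasureSpace α] (A : Set α) (K : ℝ → ℝ) (h : ℝ)
    (w : α → α → ℝ) (u : α → ℝ) (x : α) (s : ℝ) : ℝ :=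
  scaledKernel K h (u x - decRearr A u s) * relRearr A u (w x) s

/-- The integrand of the numerator of `F_h^* u(x)`. -/
def filterIntegrandStar {α : Type*} [MeasureSpace α] (A : Set α) (K : ℝ → ℝ) (h : ℝ)
    (w : α → α → ℝ) (u : α → ℝ) (x : α) (s : ℝ) : ℝ :=
  scaledKernel K h (u x - decRearr A u s) * decRearr A u s * relRearr A u (w x) s

/-- The rearranged filter `F_h^* u(x)`. -/
def rearrangedFilter {α : Type*} [MeasureSpace α] (A : Set α) (K : ℝ → ℝ) (h : ℝ)
    (w : α → α → ℝ) (u : α → ℝ) (x : α) : ℝ :=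
  (∫ s in Ioo 0 (volume.real A), filterIntegrandStar A K h w u x s) /
    ∫ s in Ioo 0 (volume.real A), normIntegrandStar A K h w u x s

end

end NonlocalFilter

/-!
The decreasing rearrangement `u_*` is, on `(0, |A|)`, the generalized inverse of the distribution
function: `q < u_*(s)` if and only if `s < |{u > q}|` (`lt_decRearr_iff`). Hence
`{u_* > q} = (0, |{u > q}|)`, and `u_*` has the distribution of `u` (`map_decRearr`).

Let `W` be the primitive of the relative rearrangement, and let `c ≤ b ≤ C` almost everywhere. The
increment `W(t) - W(s)` collects the values of `b` on a set of measure `t - s`; where a flat region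
of `u` is cut, the values are those of the rearrangement of `b` on that region, which lie between
`c` and `C` too. So `c (t - s) ≤ W(t) - W(s) ≤ C (t - s)` (`relPrimitive_sub_mem_Icc`). These bounds
persist when `W` is extended by `W(0) = 0` and `W(|A|) = ∫_A b`. Thus `W` is Lipschitz, its
derivative `b_{*u}` is bounded (and nonnegative if `b` is), and since
`W(|{u > q}|) = ∫_{u > q} b` (`relPrimitiveExt_distributionFun`) the fundamental theorem of calculus
gives `∫_{u_* > q} b_{*u} = ∫_{u > q} b` for every `q` (`integral_relRearr_distributionFun`).

For `b + k ≥ 0` this says that the measures `(b + k) dy` and `(b_{*u} + k) ds` have images under `u`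
and `u_*` with the same tails, so the images coincide (`map_withDensity_relRearr`). Integrability
and integrals of `f(u) (b + k)` and `f(u_*) (b_{*u} + k)` therefore agree for every Borel `f`. For
bounded `f` the shift `k` is removed by equidistribution. For the filter, fix `x` and take
`b = w(x, ·) ≥ 0`, `k = 0`, and `f(t) = 𝒦_h(u(x) - t)` or `f(t) = 𝒦_h(u(x) - t) t`; as `f` may be
unbounded, the formula without boundedness is what yields the equivalence of integrability.
-/

namespace NonlocalFilter

open Filter Topology

variable {α : Type*} [MeasureSpace α] {A : Set α} {u b : α → ℝ}

/-! ### Tails of finite measures on the line -/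

theorem tendsto_tail_right (μ : Measure ℝ) [IsFiniteMeasure μ] (q : ℝ) :
    Tendsto (fun n : ℕ => μ.real (Ioi (q + 1 / ((n : ℝ) + 1)))) atTop (𝓝 (μ.real (Ioi q))) := by
  have hmono : Monotone (fun n : ℕ => Ioi (q + 1 / ((n : ℝ) + 1))) := fun m n hmn =>
    Ioi_subset_Ioi (by gcongr)
  have hU : ⋃ n : ℕ, Ioi (q + 1 / ((n : ℝ) + 1)) = Ioi q := by
    ext x
    simp only [mem_iUnion, mem_Ioi]
    refine ⟨fun ⟨n, hn⟩ => lt_trans (by simp; positivity) hn, fun hx => ?_⟩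
    obtain ⟨n, hn⟩ := exists_nat_one_div_lt (sub_pos.2 hx)
    exact ⟨n, by linarith⟩
  have h := tendsto_measure_iUnion_atTop (μ := μ) hmono
  rw [hU] at h
  exact (ENNReal.tendsto_toReal (measure_ne_top _ _)).comp h

/-- The tail is not left continuous: the limit includes the atom at `q`. -/
theorem tendsto_tail_left (μ : Measure ℝ) [IsFiniteMeasure μ] (q : ℝ) :
    Tendsto (fun n : ℕ => μ.real (Ioi (q - 1 / ((n : ℝ) + 1)))) atTop (𝓝 (μ.real (Ici q))) := by
  have hanti : Antitone (fun n : ℕ => Ioi (q - 1 / ((n : ℝ) + 1))) := fun m n hmn =>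
    Ioi_subset_Ioi (by gcongr)
  have hI : ⋂ n : ℕ, Ioi (q - 1 / ((n : ℝ) + 1)) = Ici q := by
    ext x
    simp only [mem_iInter, mem_Ioi, mem_Ici]
    refine ⟨fun hx => ?_, fun hx n => lt_of_lt_of_le (by simp; positivity) hx⟩
    by_contra! hlt
    obtain ⟨n, hn⟩ := exists_nat_one_div_lt (sub_pos.2 hlt)
    linarith [hx n]
  have h := tendsto_measure_iInter_atTop (μ := μ)
    (fun n : ℕ => (measurableSet_Ioi (a := q - 1 / ((n : ℝ) + 1))).nullMeasurableSet) hanti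
    ⟨0, measure_ne_top _ _⟩
  rw [hI] at h
  exact (ENNReal.tendsto_toReal (measure_ne_top _ _)).comp h

theorem exists_tail_lt (μ : Measure ℝ) [IsFiniteMeasure μ] {s : ℝ} (hs : 0 < s) :
    ∃ q, μ.real (Ioi q) < s := by
  have hanti : Antitone (fun n : ℕ => Ioi (n : ℝ)) := fun m n hmn =>
    Ioi_subset_Ioi (by exact_mod_cast hmn)
  have hI : ⋂ n : ℕ, Ioi (n : ℝ) = ∅ := by
    ext x
    simp only [mem_iInter, mem_Ioi, mem_empty_iff_false, iff_false, not_forall, not_lt]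
    exact exists_nat_ge x
  have h := tendsto_measure_iInter_atTop (μ := μ)
    (fun n : ℕ => (measurableSet_Ioi (a := (n : ℝ))).nullMeasurableSet) hanti
    ⟨0, measure_ne_top _ _⟩
  rw [hI, measure_empty] at h
  have h' := (ENNReal.tendsto_toReal ENNReal.zero_ne_top).comp h
  obtain ⟨n, hn⟩ := (h'.eventually_lt_const (by simpa using hs)).exists
  exact ⟨n, hn⟩

theorem tendsto_tail_univ (μ : Measure ℝ) :
    Tendsto (fun n : ℕ => μ (Ioi (-(n : ℝ)))) atTop (𝓝 (μ univ)) := by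
  have hmono : Monotone (fun n : ℕ => Ioi (-(n : ℝ))) := fun m n hmn =>
    Ioi_subset_Ioi (by simpa using hmn)
  have hU : ⋃ n : ℕ, Ioi (-(n : ℝ)) = univ := by
    ext x
    simp only [mem_iUnion, mem_Ioi, mem_univ, iff_true]
    obtain ⟨n, hn⟩ := exists_nat_gt (-x)
    exact ⟨n, by linarith⟩
  rw [← hU]
  exact tendsto_measure_iUnion_atTop hmono

theorem exists_lt_tail (μ : Measure ℝ) [IsFiniteMeasure μ] {s : ℝ} (hs : s < μ.real univ) :
    ∃ q, s < μ.real (Ioi q) := by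
  have h := (ENNReal.tendsto_toReal (measure_ne_top μ univ)).comp (tendsto_tail_univ μ)
  obtain ⟨n, hn⟩ := (h.eventually_const_lt hs).exists
  exact ⟨-n, hn⟩

/-- Finite measures on the line are determined by their tails. -/
theorem ext_of_tails (μ ν : Measure ℝ) [IsFiniteMeasure μ]
    (h : ∀ q, μ (Ioi q) = ν (Ioi q)) : μ = ν := by
  refine ext_of_generate_finite (range Ioi) (borel_eq_generateFrom_Ioi ℝ ▸
    (BorelSpace.measurable_eq (α := ℝ))) isPiSystem_Ioi ?_ ?_
  · rintro _ ⟨q, rfl⟩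
    exact h q
  · refine tendsto_nhds_unique (tendsto_tail_univ μ) ?_
    simp only [h]
    exact tendsto_tail_univ ν

/-! ### The decreasing rearrangement -/

theorem distributionFun_eq (hA : NullMeasurableSet A) (hu : AEMeasurable u (volume.restrict A))
    (q : ℝ) : distributionFun A u q = ((volume.restrict A).map u).real (Ioi q) := by
  have hset : {x | x ∈ A ∧ q < u x} = u ⁻¹' Ioi q ∩ A := by
    ext x; simp [and_comm]
  rw [distributionFun, hset, Measure.real, Measure.real, Measure.map_apply_of_aemeasurable hu
    measurableSet_Ioi, Measure.restrict_apply₀' hA]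

theorem map_real_univ (hu : AEMeasurable u (volume.restrict A)) :
    ((volume.restrict A).map u).real univ = volume.real A := by
  rw [Measure.real, Measure.map_apply_of_aemeasurable hu MeasurableSet.univ]
  simp [Measure.real]

/-- On `(0, |A|)` the rearrangement is the generalized inverse of the distribution function. -/
theorem decRearr_le_iff (hA : NullMeasurableSet A) (hAf : volume A ≠ ∞)
    (hu : AEMeasurable u (volume.restrict A)) {s : ℝ} (hs : s ∈ Ioo 0 (volume.real A)) (q : ℝ) :
    decRearr A u s ≤ q ↔ distributionFun A u q ≤ s := by
  have : IsFiniteMeasure (volume.restrict A) := isFiniteMeasure_restrict.2 hAf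
  set μ := (volume.restrict A).map u
  have hD : ∀ q, distributionFun A u q = μ.real (Ioi q) := distributionFun_eq hA hu
  have hanti : ∀ {p q}, p ≤ q → distributionFun A u q ≤ distributionFun A u p := fun hpq => by
    rw [hD, hD]; exact measureReal_mono (Ioi_subset_Ioi hpq)
  have hne : {q : ℝ | distributionFun A u q ≤ s}.Nonempty := by
    obtain ⟨q, hq⟩ := exists_tail_lt μ hs.1
    exact ⟨q, by rw [mem_ofPred_eq, hD]; exact hq.le⟩
  have hbdd : BddBelow {q : ℝ | distributionFun A u q ≤ s} := by
    obtain ⟨p, hp⟩ := exists_lt_tail μ (s := s) (by rw [map_real_univ hu]; exact hs.2)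
    refine ⟨p, fun q hq => ?_⟩
    by_contra! hlt
    have h1 := hanti hlt.le
    rw [hD p] at h1
    exact absurd (hp.trans_le (h1.trans hq)) (lt_irrefl _)
  rw [decRearr, if_neg hs.1.ne', if_neg hs.2.ne]
  refine ⟨fun h => ?_, fun h => csInf_le hbdd h⟩
  rw [hD]
  refine le_of_tendsto (tendsto_tail_right μ q) (Eventually.of_forall fun n => ?_)
  have hlt : sInf {q : ℝ | distributionFun A u q ≤ s} < q + 1 / ((n : ℝ) + 1) :=
    h.trans_lt (by simp; positivity)
  obtain ⟨r, hr, hrlt⟩ := exists_lt_of_csInf_lt hne hlt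
  rw [← hD]
  exact (hanti hrlt.le).trans hr

theorem lt_decRearr_iff (hA : NullMeasurableSet A) (hAf : volume A ≠ ∞)
    (hu : AEMeasurable u (volume.restrict A)) {s : ℝ} (hs : s ∈ Ioo 0 (volume.real A)) (q : ℝ) :
    q < decRearr A u s ↔ s < distributionFun A u q := by
  rw [← not_le, decRearr_le_iff hA hAf hu hs, not_le]

theorem decRearr_antitoneOn (hA : NullMeasurableSet A) (hAf : volume A ≠ ∞)
    (hu : AEMeasurable u (volume.restrict A)) :
    AntitoneOn (decRearr A u) (Ioo 0 (volume.real A)) := fun s hs t ht hst => by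
  rw [decRearr_le_iff hA hAf hu ht]
  exact ((decRearr_le_iff hA hAf hu hs _).1 le_rfl).trans hst

theorem aemeasurable_decRearr (hA : NullMeasurableSet A) (hAf : volume A ≠ ∞)
    (hu : AEMeasurable u (volume.restrict A)) :
    AEMeasurable (decRearr A u) (volume.restrict (Ioo 0 (volume.real A))) :=
  aemeasurable_restrict_of_antitoneOn measurableSet_Ioo (decRearr_antitoneOn hA hAf hu)

theorem distributionFun_nonneg (q : ℝ) : 0 ≤ distributionFun A u q := measureReal_nonneg

theorem distributionFun_le (hAf : volume A ≠ ∞) (q : ℝ) :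
    distributionFun A u q ≤ volume.real A :=
  measureReal_mono (fun _ hx => hx.1) hAf

theorem preimage_decRearr_Ioi (hA : NullMeasurableSet A) (hAf : volume A ≠ ∞)
    (hu : AEMeasurable u (volume.restrict A)) (q : ℝ) :
    decRearr A u ⁻¹' Ioi q ∩ Ioo 0 (volume.real A) = Ioo 0 (distributionFun A u q) := by
  ext s
  constructor
  · rintro ⟨h, hs⟩
    exact ⟨hs.1, (lt_decRearr_iff hA hAf hu hs q).1 h⟩
  · intro hs
    have hs' : s ∈ Ioo 0 (volume.real A) := ⟨hs.1, hs.2.trans_le (distributionFun_le hAf q)⟩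
    exact ⟨(lt_decRearr_iff hA hAf hu hs' q).2 hs.2, hs'⟩

/-- A function and its decreasing rearrangement are equidistributed. -/
theorem map_decRearr (hA : NullMeasurableSet A) (hAf : volume A ≠ ∞)
    (hu : AEMeasurable u (volume.restrict A)) :
    (volume.restrict (Ioo 0 (volume.real A))).map (decRearr A u) =
      (volume.restrict A).map u := by
  have : IsFiniteMeasure (volume.restrict A) := isFiniteMeasure_restrict.2 hAf
  have hm := aemeasurable_decRearr hA hAf hu
  refine ext_of_tails _ _ fun q => ?_
  rw [Measure.map_apply_of_aemeasurable hm measurableSet_Ioi,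
    Measure.restrict_apply₀' measurableSet_Ioo.nullMeasurableSet,
    preimage_decRearr_Ioi hA hAf hu, Real.volume_Ioo, sub_zero, distributionFun_eq hA hu,
    Measure.real, ENNReal.ofReal_toReal (measure_ne_top _ _)]

theorem integral_decRearr (hA : NullMeasurableSet A) (hAf : volume A ≠ ∞)
    (hu : AEMeasurable u (volume.restrict A)) :
    ∫ s in (0 : ℝ)..volume.real A, decRearr A u s = ∫ x in A, u x := by
  rw [intervalIntegral.integral_of_le measureReal_nonneg, integral_Ioc_eq_integral_Ioo]
  have h1 := integral_map (aemeasurable_decRearr hA hAf hu)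
    (f := fun t : ℝ => t) aestronglyMeasurable_id
  have h2 := integral_map hu (f := fun t : ℝ => t) aestronglyMeasurable_id
  rw [← h1, ← h2, map_decRearr hA hAf hu]

theorem decRearr_mem_Icc (hA : NullMeasurableSet A) (hAf : volume A ≠ ∞)
    (hu : AEMeasurable u (volume.restrict A)) {c C : ℝ}
    (hc : ∀ᵐ x ∂volume.restrict A, u x ∈ Icc c C)
    {s : ℝ} (hs : s ∈ Ioo 0 (volume.real A)) : decRearr A u s ∈ Icc c C := by
  constructor
  · refine le_of_forall_lt fun q hq => ?_
    rw [lt_decRearr_iff hA hAf hu hs]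
    refine hs.2.trans_le (le_of_eq ?_)
    rw [distributionFun_eq hA hu, ← map_real_univ hu, Measure.real, Measure.real]
    congr 1
    rw [Measure.map_apply_of_aemeasurable hu measurableSet_Ioi,
      Measure.map_apply_of_aemeasurable hu .univ]
    refine measure_congr ?_
    filter_upwards [hc] with x hx
    exact propext (iff_of_true trivial (hq.trans_le hx.1))
  · rw [decRearr_le_iff hA hAf hu hs]
    refine le_trans (le_of_eq ?_) hs.1.le
    rw [distributionFun_eq hA hu, Measure.real,
      Measure.map_apply_of_aemeasurable hu measurableSet_Ioi]
    have : volume.restrict A (u ⁻¹' Ioi C) = 0 := by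
      have hC : ∀ᵐ x ∂volume.restrict A, u x ≤ C := hc.mono fun x hx => hx.2
      exact measure_mono_null (fun x (hx : C < u x) => not_le.2 hx) (ae_iff.1 hC)
    simp [this]

theorem nullMeasurableSet_levelSet (hA : NullMeasurableSet A)
    (hu : AEMeasurable u (volume.restrict A)) (q : ℝ) :
    NullMeasurableSet (levelSet A u q) := by
  have h : NullMeasurableSet (u ⁻¹' {q}) (volume.restrict A) :=
    hu.nullMeasurableSet_preimage (measurableSet_singleton q)
  have h' := (nullMeasurableSet_restrict hA).1 h
  convert h' using 1
  ext x; simp [levelSet, and_comm]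

/-- The jump of the distribution function at `q` is the measure of the flat region. -/
theorem map_real_Ici (hA : NullMeasurableSet A) (hAf : volume A ≠ ∞)
    (hu : AEMeasurable u (volume.restrict A)) (q : ℝ) :
    ((volume.restrict A).map u).real (Ici q) =
      distributionFun A u q + volume.real (levelSet A u q) := by
  have : IsFiniteMeasure (volume.restrict A) := isFiniteMeasure_restrict.2 hAf
  have hP : volume.real (levelSet A u q) = ((volume.restrict A).map u).real {q} := by
    rw [Measure.real, Measure.real, Measure.map_apply_of_aemeasurable hu
      (measurableSet_singleton q), Measure.restrict_apply₀' hA]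
    congr 2
    ext x; simp [levelSet, and_comm]
  rw [hP, distributionFun_eq hA hu, ← measureReal_union (by simp) (measurableSet_singleton q),
    Ioi_union_left]

/-- The point `s` lies between the masses of `{u > u_*(s)}` and `{u ≥ u_*(s)}`. -/
theorem mem_Icc_distributionFun_decRearr (hA : NullMeasurableSet A) (hAf : volume A ≠ ∞)
    (hu : AEMeasurable u (volume.restrict A)) {s : ℝ} (hs : s ∈ Ioo 0 (volume.real A)) :
    s ∈ Icc (distributionFun A u (decRearr A u s)) (distributionFun A u (decRearr A u s) +
      volume.real (levelSet A u (decRearr A u s))) := by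
  have : IsFiniteMeasure (volume.restrict A) := isFiniteMeasure_restrict.2 hAf
  refine ⟨(decRearr_le_iff hA hAf hu hs _).1 le_rfl, ?_⟩
  rw [← map_real_Ici hA hAf hu]
  refine ge_of_tendsto (tendsto_tail_left _ _) (Eventually.of_forall fun n => ?_)
  rw [← distributionFun_eq hA hu]
  refine ((lt_decRearr_iff hA hAf hu hs _).1 ?_).le
  simp; positivity

/-! ### The primitive of the relative rearrangement -/

theorem integrable_of_ae_mem_Icc {β : Type*} [MeasurableSpace β] {μ : Measure β}
    [IsFiniteMeasure μ] {b : β → ℝ} (hb : AEMeasurable b μ) {c C : ℝ}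
    (hbd : ∀ᵐ x ∂μ, b x ∈ Icc c C) : Integrable b μ := by
  refine Integrable.of_bound hb.aestronglyMeasurable (max |c| |C|) ?_
  filter_upwards [hbd] with x hx
  exact abs_le_max_abs_abs hx.1 hx.2

theorem integral_mem_Icc_of_ae_mem_Icc {β : Type*} [MeasurableSpace β] {μ : Measure β}
    [IsFiniteMeasure μ] {b : β → ℝ} (hb : AEMeasurable b μ) {c C : ℝ}
    (hbd : ∀ᵐ x ∂μ, b x ∈ Icc c C) :
    ∫ x, b x ∂μ ∈ Icc (c * μ.real univ) (C * μ.real univ) := by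
  have hi := integrable_of_ae_mem_Icc hb hbd
  constructor
  · have := integral_mono_ae (integrable_const c) hi (hbd.mono fun x hx => hx.1)
    simpa [mul_comm] using this
  · have := integral_mono_ae hi (integrable_const C) (hbd.mono fun x hx => hx.2)
    simpa [mul_comm] using this

/-- The difference is the integral of `b` over `u⁻¹(T \ S)`. -/
theorem setIntegral_preimage_sub_mem_Icc {β : Type*} [MeasurableSpace β] {ν : Measure β}
    [IsFiniteMeasure ν] {u b : β → ℝ} (hu : AEMeasurable u ν) (hb : AEMeasurable b ν) {c C : ℝ}
    (hbd : ∀ᵐ x ∂ν, b x ∈ Icc c C) {S T : Set ℝ} (hS : MeasurableSet S) (hT : MeasurableSet T)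
    (hST : S ⊆ T) :
    ∫ x in u ⁻¹' T, b x ∂ν - ∫ x in u ⁻¹' S, b x ∂ν ∈
      Icc (c * ((ν.map u).real T - (ν.map u).real S))
        (C * ((ν.map u).real T - (ν.map u).real S)) := by
  have hi := integrable_of_ae_mem_Icc hb hbd
  have hS' : NullMeasurableSet (u ⁻¹' S) ν := hu.nullMeasurableSet_preimage hS
  have hD' : NullMeasurableSet (u ⁻¹' (T \ S)) ν := hu.nullMeasurableSet_preimage (hT.diff hS)
  have hI : ∫ x in u ⁻¹' T, b x ∂ν = ∫ x in u ⁻¹' S, b x ∂ν + ∫ x in u ⁻¹' (T \ S), b x ∂ν := by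
    rw [← setIntegral_union₀ _ hD' hi.integrableOn hi.integrableOn, ← preimage_union,
      union_sdiff_cancel hST]
    exact (disjoint_sdiff_right.preimage u).aedisjoint
  have hm := integral_mem_Icc_of_ae_mem_Icc (μ := ν.restrict (u ⁻¹' (T \ S)))
    hb.restrict (ae_restrict_of_ae hbd)
  have hv : (ν.restrict (u ⁻¹' (T \ S))).real univ = (ν.map u).real T - (ν.map u).real S := by
    rw [← measureReal_sdiff hST hS, Measure.real, Measure.real, Measure.restrict_apply_univ,
      Measure.map_apply_of_aemeasurable hu (hT.diff hS)]
  rw [hI, add_sub_cancel_left, ← hv]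
  exact hm

theorem restrict_setOf_and (hu : AEMeasurable u (volume.restrict A)) {T : Set ℝ}
    (hT : MeasurableSet T) :
    volume.restrict {x | x ∈ A ∧ u x ∈ T} = (volume.restrict A).restrict (u ⁻¹' T) := by
  rw [Measure.restrict_restrict₀ (hu.nullMeasurableSet_preimage hT)]
  congr 1
  ext x; simp [and_comm]

theorem intervalIntegrable_decRearr (hA : NullMeasurableSet A) (hAf : volume A ≠ ∞)
    (hb : AEMeasurable b (volume.restrict A)) {c C : ℝ}
    (hbd : ∀ᵐ x ∂volume.restrict A, b x ∈ Icc c C) {s t : ℝ} (hs : 0 ≤ s) (hst : s ≤ t)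
    (ht : t ≤ volume.real A) : IntervalIntegrable (decRearr A b) volume s t := by
  rw [intervalIntegrable_iff_integrableOn_Ioo_of_le hst]
  refine IntegrableOn.mono_set ?_ (Ioo_subset_Ioo hs ht)
  refine integrable_of_ae_mem_Icc (aemeasurable_decRearr hA hAf hb) (c := c) (C := C) ?_
  filter_upwards [ae_restrict_mem measurableSet_Ioo] with x hx
  exact decRearr_mem_Icc hA hAf hb hbd hx

theorem intervalIntegral_decRearr_mem_Icc (hA : NullMeasurableSet A) (hAf : volume A ≠ ∞)
    (hb : AEMeasurable b (volume.restrict A)) {c C : ℝ}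
    (hbd : ∀ᵐ x ∂volume.restrict A, b x ∈ Icc c C) {s t : ℝ} (hs : 0 ≤ s) (hst : s ≤ t)
    (ht : t ≤ volume.real A) :
    ∫ σ in s..t, decRearr A b σ ∈ Icc (c * (t - s)) (C * (t - s)) := by
  have hi := intervalIntegrable_decRearr hA hAf hb hbd hs hst ht
  have hm : ∀ x ∈ Ioo s t, decRearr A b x ∈ Icc c C := fun x hx =>
    decRearr_mem_Icc hA hAf hb hbd (Ioo_subset_Ioo hs ht hx)
  constructor
  · have := intervalIntegral.integral_mono_on_of_le_Ioo hst (intervalIntegrable_const (c := c)) hi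
      fun x hx => (hm x hx).1
    simpa [mul_comm] using this
  · have := intervalIntegral.integral_mono_on_of_le_Ioo hst hi (intervalIntegrable_const (c := C))
      fun x hx => (hm x hx).2
    simpa [mul_comm] using this

/-- The value of the primitive at `s`, with the level `u_*(s)` replaced by a free parameter `q`. -/
noncomputable def cutIntegral (A : Set α) (u b : α → ℝ) (q s : ℝ) : ℝ :=
  (∫ x in {x | x ∈ A ∧ q < u x}, b x) +
    ∫ σ in (0 : ℝ)..(s - distributionFun A u q), decRearr (levelSet A u q) b σ

theorem levelSet_subset {β : Type*} {A : Set β} {u : β → ℝ} (q : ℝ) : levelSet A u q ⊆ A := fun _ hx => hx.1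

theorem cutIntegral_sub_cutIntegral_mem_Icc (hA : NullMeasurableSet A) (hAf : volume A ≠ ∞)
    (hu : AEMeasurable u (volume.restrict A)) (hb : AEMeasurable b (volume.restrict A)) {c C : ℝ}
    (hbd : ∀ᵐ x ∂volume.restrict A, b x ∈ Icc c C) {q s t : ℝ}
    (hs : distributionFun A u q ≤ s) (hst : s ≤ t)
    (ht : t ≤ distributionFun A u q + volume.real (levelSet A u q)) :
    cutIntegral A u b q t - cutIntegral A u b q s ∈ Icc (c * (t - s)) (C * (t - s)) := by
  have hP := nullMeasurableSet_levelSet hA hu q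
  have hPf : volume (levelSet A u q) ≠ ∞ := measure_ne_top_of_subset (levelSet_subset q) hAf
  have hle := Measure.restrict_mono_set volume (levelSet_subset (A := A) (u := u) q)
  have hb' := hb.mono_measure hle
  have hbd' := ae_mono hle hbd
  have h := intervalIntegral_decRearr_mem_Icc hP hPf hb' hbd' (sub_nonneg.2 hs)
    (sub_le_sub_right hst _) (by linarith : t - distributionFun A u q ≤ _)
  rw [← intervalIntegral.integral_interval_sub_left
    (intervalIntegrable_decRearr hP hPf hb' hbd' le_rfl (by linarith) (by linarith))
    (intervalIntegrable_decRearr hP hPf hb' hbd' le_rfl (by linarith) (by linarith)),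
    sub_sub_sub_cancel_right] at h
  rwa [cutIntegral, cutIntegral, add_sub_add_left_eq_sub]

/-- At the left end of a flat region the rearrangement on that region contributes nothing. -/
theorem cutIntegral_left (hu : AEMeasurable u (volume.restrict A)) (q : ℝ) :
    cutIntegral A u b q (distributionFun A u q) = ∫ x in u ⁻¹' Ioi q, b x ∂volume.restrict A := by
  rw [← restrict_setOf_and hu measurableSet_Ioi]
  simp [cutIntegral]

/-- When the flat region is used up, its rearrangement has contributed the full integral of `b`
over it. -/
theorem cutIntegral_right (hA : NullMeasurableSet A) (hAf : volume A ≠ ∞)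
    (hu : AEMeasurable u (volume.restrict A)) (hb : AEMeasurable b (volume.restrict A)) {c C : ℝ}
    (hbd : ∀ᵐ x ∂volume.restrict A, b x ∈ Icc c C) (q : ℝ) :
    cutIntegral A u b q (distributionFun A u q + volume.real (levelSet A u q)) =
      ∫ x in u ⁻¹' Ici q, b x ∂volume.restrict A := by
  have : IsFiniteMeasure (volume.restrict A) := isFiniteMeasure_restrict.2 hAf
  have hi := integrable_of_ae_mem_Icc hb hbd
  have hP := nullMeasurableSet_levelSet hA hu q
  have hPf : volume (levelSet A u q) ≠ ∞ := measure_ne_top_of_subset (levelSet_subset q) hAf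
  have hle := Measure.restrict_mono_set volume (levelSet_subset (A := A) (u := u) q)
  have hG : ∫ x in {x | x ∈ A ∧ q < u x}, b x =
      ∫ x in u ⁻¹' Ioi q, b x ∂volume.restrict A := by
    rw [← restrict_setOf_and hu measurableSet_Ioi]; rfl
  have hL : ∫ x in levelSet A u q, b x = ∫ x in u ⁻¹' {q}, b x ∂volume.restrict A := by
    rw [← restrict_setOf_and hu (measurableSet_singleton q)]; rfl
  rw [cutIntegral, add_sub_cancel_left, integral_decRearr hP hPf (hb.mono_measure hle), hG, hL,
    ← setIntegral_union₀ _ (hu.nullMeasurableSet_preimage (measurableSet_singleton q))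
      hi.integrableOn hi.integrableOn, ← preimage_union, Ioi_union_left]
  exact (Disjoint.preimage u (by simp)).aedisjoint

section Primitive

variable (hA : NullMeasurableSet A) (hAf : volume A ≠ ∞)
    (hu : AEMeasurable u (volume.restrict A)) (hb : AEMeasurable b (volume.restrict A)) {c C : ℝ}
    (hbd : ∀ᵐ x ∂volume.restrict A, b x ∈ Icc c C)

include hA hAf hu hb hbd

/-- Moving from `s` to `t` adds a set of measure `t - s`, on which `b` lies between `c` and `C`. -/
theorem relPrimitive_sub_mem_Icc {s t : ℝ} (hs : s ∈ Ioo 0 (volume.real A))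
    (ht : t ∈ Ioo 0 (volume.real A)) (hst : s ≤ t) :
    relPrimitive A u b t - relPrimitive A u b s ∈ Icc (c * (t - s)) (C * (t - s)) := by
  have : IsFiniteMeasure (volume.restrict A) := isFiniteMeasure_restrict.2 hAf
  have hms := mem_Icc_distributionFun_decRearr hA hAf hu hs
  have hmt := mem_Icc_distributionFun_decRearr hA hAf hu ht
  change cutIntegral A u b (decRearr A u t) t - cutIntegral A u b (decRearr A u s) s ∈ _
  rcases (decRearr_antitoneOn hA hAf hu hs ht hst).eq_or_lt with heq | hlt
  · rw [heq] at hmt ⊢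
    exact cutIntegral_sub_cutIntegral_mem_Icc hA hAf hu hb hbd hms.1 hst hmt.2
  -- With `r = u_*(t) < q = u_*(s)` the increment splits into the remainder of the flat region at
  -- `q`, the set `{r < u < q}`, and the initial part of the flat region at `r`.
  · generalize decRearr A u s = q at *
    generalize decRearr A u t = r at *
    have h1 := cutIntegral_sub_cutIntegral_mem_Icc hA hAf hu hb hbd hms.1 hms.2 le_rfl
    have h2 := cutIntegral_sub_cutIntegral_mem_Icc hA hAf hu hb hbd le_rfl hmt.1 hmt.2
    have h3 := setIntegral_preimage_sub_mem_Icc hu hb hbd measurableSet_Ici measurableSet_Ioi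
      (Ici_subset_Ioi.2 hlt)
    rw [cutIntegral_right hA hAf hu hb hbd] at h1
    rw [cutIntegral_left hu] at h2
    rw [map_real_Ici hA hAf hu, ← distributionFun_eq hA hu] at h3
    constructor
    · linarith [h1.1, h2.1, h3.1]
    · linarith [h1.2, h2.2, h3.2]

theorem relPrimitive_mem_Icc {s : ℝ} (hs : s ∈ Ioo 0 (volume.real A)) :
    relPrimitive A u b s ∈ Icc (c * s) (C * s) := by
  have : IsFiniteMeasure (volume.restrict A) := isFiniteMeasure_restrict.2 hAf
  have hms := mem_Icc_distributionFun_decRearr hA hAf hu hs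
  change cutIntegral A u b (decRearr A u s) s ∈ _
  generalize decRearr A u s = q at *
  have h2 := cutIntegral_sub_cutIntegral_mem_Icc hA hAf hu hb hbd le_rfl hms.1 hms.2
  have h3 := setIntegral_preimage_sub_mem_Icc hu hb hbd .empty measurableSet_Ioi
    (empty_subset (Ioi q))
  rw [cutIntegral_left hu] at h2
  rw [← distributionFun_eq hA hu] at h3
  simp only [preimage_empty, Measure.restrict_empty, integral_zero_measure, measureReal_empty,
    sub_zero] at h3
  constructor
  · linarith [h2.1, h3.1]
  · linarith [h2.2, h3.2]

theorem integral_sub_relPrimitive_mem_Icc {s : ℝ} (hs : s ∈ Ioo 0 (volume.real A)) :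
    (∫ x in A, b x) - relPrimitive A u b s ∈
      Icc (c * (volume.real A - s)) (C * (volume.real A - s)) := by
  have : IsFiniteMeasure (volume.restrict A) := isFiniteMeasure_restrict.2 hAf
  have hms := mem_Icc_distributionFun_decRearr hA hAf hu hs
  change _ - cutIntegral A u b (decRearr A u s) s ∈ _
  generalize decRearr A u s = q at *
  have h1 := cutIntegral_sub_cutIntegral_mem_Icc hA hAf hu hb hbd hms.1 hms.2 le_rfl
  have h3 := setIntegral_preimage_sub_mem_Icc hu hb hbd measurableSet_Ici .univ
    (subset_univ (Ici q))
  rw [cutIntegral_right hA hAf hu hb hbd] at h1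
  rw [map_real_Ici hA hAf hu, map_real_univ hu] at h3
  simp only [preimage_univ, Measure.restrict_univ] at h3
  constructor
  · linarith [h1.1, h3.1]
  · linarith [h1.2, h3.2]

end Primitive

/-- The primitive of the relative rearrangement, extended from `(0, |A|)` to `[0, |A|]` by its
limits `0` and `∫_A b`. -/
noncomputable def relPrimitiveExt (A : Set α) (u b : α → ℝ) (s : ℝ) : ℝ :=
  if s ≤ 0 then 0 else if s < volume.real A then relPrimitive A u b s else ∫ x in A, b x

theorem relPrimitiveExt_of_mem {s : ℝ} (hs : s ∈ Ioo 0 (volume.real A)) :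
    relPrimitiveExt A u b s = relPrimitive A u b s := by
  rw [relPrimitiveExt, if_neg hs.1.not_ge, if_pos hs.2]

/-- The two limits defining the extension preserve the bounds on the increments, so that the
extension is Lipschitz up to the end points. -/
theorem relPrimitiveExt_sub_mem_Icc (hA : NullMeasurableSet A) (hAf : volume A ≠ ∞)
    (hu : AEMeasurable u (volume.restrict A)) (hb : AEMeasurable b (volume.restrict A)) {c C : ℝ}
    (hbd : ∀ᵐ x ∂volume.restrict A, b x ∈ Icc c C)
    {s t : ℝ} (hs : s ∈ Icc 0 (volume.real A))
    (ht : t ∈ Icc 0 (volume.real A)) (hst : s ≤ t) :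
    relPrimitiveExt A u b t - relPrimitiveExt A u b s ∈ Icc (c * (t - s)) (C * (t - s)) := by
  have : IsFiniteMeasure (volume.restrict A) := isFiniteMeasure_restrict.2 hAf
  rcases hst.eq_or_lt with rfl | hlt
  · simp
  rcases hs.1.eq_or_lt with rfl | hs0 <;> rcases ht.2.eq_or_lt with rfl | htL
  · simpa [relPrimitiveExt, hlt.not_ge] using integral_mem_Icc_of_ae_mem_Icc hb hbd
  · have h := relPrimitive_mem_Icc hA hAf hu hb hbd (s := t) ⟨hlt, htL⟩
    rw [relPrimitiveExt_of_mem ⟨hlt, htL⟩]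
    simpa [relPrimitiveExt] using h
  · have h := integral_sub_relPrimitive_mem_Icc hA hAf hu hb hbd (s := s) ⟨hs0, hlt⟩
    rw [relPrimitiveExt_of_mem ⟨hs0, hlt⟩]
    simpa only [relPrimitiveExt, if_neg (hs0.trans hlt).not_ge, lt_irrefl, if_false] using h
  · rw [relPrimitiveExt_of_mem ⟨hs0, hlt.trans htL⟩, relPrimitiveExt_of_mem ⟨hs0.trans hlt, htL⟩]
    exact relPrimitive_sub_mem_Icc hA hAf hu hb hbd ⟨hs0, hlt.trans htL⟩ ⟨hs0.trans hlt, htL⟩ hst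

/-- At `s = |{u > q}|` the primitive is the integral of `b` over `{u > q}`. The level `u_*(s)` may lie
below `q`, but then `u` takes values in `(u_*(s), q]` on a null set only. -/
theorem relPrimitiveExt_distributionFun (hA : NullMeasurableSet A) (hAf : volume A ≠ ∞)
    (hu : AEMeasurable u (volume.restrict A)) (hb : AEMeasurable b (volume.restrict A)) {c C : ℝ}
    (hbd : ∀ᵐ x ∂volume.restrict A, b x ∈ Icc c C) (q : ℝ) :
    relPrimitiveExt A u b (distributionFun A u q) =
      ∫ x in u ⁻¹' Ioi q, b x ∂volume.restrict A := by
  have : IsFiniteMeasure (volume.restrict A) := isFiniteMeasure_restrict.2 hAf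
  rcases (distributionFun_nonneg (A := A) (u := u) q).eq_or_lt with h0 | h0
  · have h3 := setIntegral_preimage_sub_mem_Icc hu hb hbd .empty measurableSet_Ioi
      (empty_subset (Ioi q))
    rw [← distributionFun_eq hA hu, ← h0] at h3
    simp at h3
    simp [relPrimitiveExt, ← h0, h3]
  rcases (distributionFun_le (u := u) hAf q).eq_or_lt with hL | hL
  · have h3 := setIntegral_preimage_sub_mem_Icc hu hb hbd measurableSet_Ioi .univ
      (subset_univ (Ioi q))
    rw [← distributionFun_eq hA hu, map_real_univ hu, ← hL] at h3
    simp at h3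
    rw [relPrimitiveExt, if_neg h0.not_ge, if_neg hL.not_lt]
    linarith
  · rw [relPrimitiveExt_of_mem ⟨h0, hL⟩]
    change cutIntegral A u b (decRearr A u (distributionFun A u q)) _ = _
    have hle := (decRearr_le_iff hA hAf hu ⟨h0, hL⟩ q).2 le_rfl
    have h1 := (mem_Icc_distributionFun_decRearr hA hAf hu ⟨h0, hL⟩).1
    generalize decRearr A u (distributionFun A u q) = p at *
    have h3 := setIntegral_preimage_sub_mem_Icc hu hb hbd measurableSet_Ioi measurableSet_Ioi
      (Ioi_subset_Ioi hle)
    have heq : distributionFun A u p = distributionFun A u q := by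
      refine h1.antisymm ?_
      rw [distributionFun_eq hA hu, distributionFun_eq hA hu]
      exact measureReal_mono (Ioi_subset_Ioi hle)
    rw [← distributionFun_eq hA hu, ← distributionFun_eq hA hu, heq] at h3
    simp at h3
    rw [← heq, cutIntegral_left hu]
    linarith

/-! ### Functions with bounded difference quotients -/

theorem lipschitzOnWith_of_sub_mem_Icc {f : ℝ → ℝ} {I : Set ℝ} {c C : ℝ}
    (hf : ∀ s ∈ I, ∀ t ∈ I, s ≤ t → f t - f s ∈ Icc (c * (t - s)) (C * (t - s))) :
    LipschitzOnWith (max |c| |C|).toNNReal f I := by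
  have key : ∀ s ∈ I, ∀ t ∈ I, s ≤ t → |f t - f s| ≤ max |c| |C| * |t - s| :=
    fun s hs t ht hst => by
      have h := hf s hs t ht hst
      have hm := abs_le_max_abs_abs h.1 h.2
      rwa [abs_mul, abs_mul, ← max_mul_of_nonneg _ _ (abs_nonneg _)] at hm
  refine LipschitzOnWith.of_dist_le_mul fun s hs t ht => ?_
  rw [Real.coe_toNNReal _ (le_max_of_le_left (abs_nonneg c)), Real.dist_eq, Real.dist_eq]
  rcases le_total s t with hst | hst
  · rw [abs_sub_comm (f s), abs_sub_comm s]
    exact key s hs t ht hst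
  · exact key t ht s hs hst

/-- The interval `[c, C]` is required to contain `0`, the value of `deriv` where `f` is not
differentiable; the bound then holds at every point of `I`. -/
theorem deriv_mem_Icc_of_sub_mem_Icc {f : ℝ → ℝ} {I : Set ℝ} (hI : IsOpen I) {c C : ℝ}
    (hf : ∀ s ∈ I, ∀ t ∈ I, s ≤ t → f t - f s ∈ Icc (c * (t - s)) (C * (t - s)))
    (hc : c ≤ 0) (hC : 0 ≤ C) {s : ℝ} (hs : s ∈ I) : deriv f s ∈ Icc c C := by
  by_cases hd : DifferentiableAt ℝ f s
  · have h1 : MonotoneOn (fun t => f t - c * t) I := fun x hx y hy hxy => by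
      have := (hf x hx y hy hxy).1
      simp only; linarith
    have h2 : MonotoneOn (fun t => C * t - f t) I := fun x hx y hy hxy => by
      have := (hf x hx y hy hxy).2
      simp only; linarith
    have hl : ∀ k : ℝ, HasDerivAt (fun t => k * t) k s := fun k => by
      simpa using (hasDerivAt_id s).const_mul k
    have d1 := h1.derivWithin_nonneg (x := s)
    have d2 := h2.derivWithin_nonneg (x := s)
    rw [derivWithin_of_isOpen hI hs, (hd.hasDerivAt.fun_sub (hl c)).deriv] at d1
    rw [derivWithin_of_isOpen hI hs, ((hl C).fun_sub hd.hasDerivAt).deriv] at d2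
    exact ⟨by linarith, by linarith⟩
  · rw [deriv_zero_of_not_differentiableAt hd]
    exact ⟨hc, hC⟩

/-! ### The relative rearrangement -/

theorem relRearr_mem_Icc (hA : NullMeasurableSet A) (hAf : volume A ≠ ∞)
    (hu : AEMeasurable u (volume.restrict A)) (hb : AEMeasurable b (volume.restrict A)) {c C : ℝ}
    (hbd : ∀ᵐ x ∂volume.restrict A, b x ∈ Icc c C) (hc : c ≤ 0) (hC : 0 ≤ C)
    {s : ℝ} (hs : s ∈ Ioo 0 (volume.real A)) : relRearr A u b s ∈ Icc c C :=
  deriv_mem_Icc_of_sub_mem_Icc isOpen_Ioo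
    (fun _ hs _ ht hst => relPrimitive_sub_mem_Icc hA hAf hu hb hbd hs ht hst) hc hC hs

theorem measurable_relRearr : Measurable (relRearr A u b) := measurable_deriv _

/-- The fundamental theorem of calculus for the extended primitive, between `0` and `|{u > q}|`. -/
theorem integral_relRearr_distributionFun (hA : NullMeasurableSet A) (hAf : volume A ≠ ∞)
    (hu : AEMeasurable u (volume.restrict A)) (hb : AEMeasurable b (volume.restrict A)) {c C : ℝ}
    (hbd : ∀ᵐ x ∂volume.restrict A, b x ∈ Icc c C) (q : ℝ) :
    ∫ s in Ioo 0 (distributionFun A u q), relRearr A u b s =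
      ∫ x in u ⁻¹' Ioi q, b x ∂volume.restrict A := by
  have h0 := distributionFun_nonneg (A := A) (u := u) q
  have hL := distributionFun_le (u := u) hAf q
  have hLip : LipschitzOnWith (max |c| |C|).toNNReal (relPrimitiveExt A u b)
      (uIcc 0 (distributionFun A u q)) := by
    rw [uIcc_of_le h0]
    exact (lipschitzOnWith_of_sub_mem_Icc fun s hs t ht hst =>
      relPrimitiveExt_sub_mem_Icc hA hAf hu hb hbd hs ht hst).mono (Icc_subset_Icc_right hL)
  have hFTC := hLip.absolutelyContinuousOnInterval.integral_deriv_eq_sub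
  rw [relPrimitiveExt_distributionFun hA hAf hu hb hbd, intervalIntegral.integral_of_le h0,
    integral_Ioc_eq_integral_Ioo] at hFTC
  rw [show relPrimitiveExt A u b 0 = 0 by simp [relPrimitiveExt], sub_zero] at hFTC
  rw [← hFTC]
  refine setIntegral_congr_fun measurableSet_Ioo fun s hs => ?_
  refine (Filter.EventuallyEq.deriv_eq ?_).symm
  filter_upwards [isOpen_Ioo.mem_nhds (Ioo_subset_Ioo_right hL hs)] with t ht
  exact relPrimitiveExt_of_mem ht

/-! ### Change of variables -/

section Pushforward

variable {β : Type*} [MeasurableSpace β] {ν : Measure β} {v g : β → ℝ}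

theorem map_withDensity_apply_Ioi [IsFiniteMeasure ν] (hv : AEMeasurable v ν)
    (hg : Integrable g ν) (hg0 : ∀ᵐ x ∂ν, 0 ≤ g x) (q : ℝ) :
    (ν.withDensity fun x => ENNReal.ofReal (g x)).map v (Ioi q) =
      ENNReal.ofReal (∫ x in v ⁻¹' Ioi q, g x ∂ν) := by
  rw [Measure.map_apply_of_aemeasurable (hv.mono_ac (withDensity_absolutelyContinuous _ _))
    measurableSet_Ioi, withDensity_apply₀ _ (hv.nullMeasurableSet_preimage measurableSet_Ioi),
    ofReal_integral_eq_lintegral_ofReal hg.restrict (ae_restrict_of_ae hg0)]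

theorem integrable_map_withDensity_iff (hv : AEMeasurable v ν) (hg : AEMeasurable g ν)
    (hg0 : ∀ᵐ x ∂ν, 0 ≤ g x) {f : ℝ → ℝ} (hf : Measurable f) :
    Integrable f ((ν.withDensity fun x => ENNReal.ofReal (g x)).map v) ↔
      Integrable (fun x => f (v x) * g x) ν := by
  rw [integrable_map_measure hf.aestronglyMeasurable
    (hv.mono_ac (withDensity_absolutelyContinuous _ _)),
    integrable_withDensity_iff_integrable_smul₀' hg.ennreal_ofReal
      (Eventually.of_forall fun x => ENNReal.ofReal_lt_top)]
  refine integrable_congr ?_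
  filter_upwards [hg0] with x hx
  rw [ENNReal.toReal_ofReal hx, smul_eq_mul, mul_comm, Function.comp]

theorem integral_map_withDensity (hv : AEMeasurable v ν) (hg : AEMeasurable g ν)
    (hg0 : ∀ᵐ x ∂ν, 0 ≤ g x) {f : ℝ → ℝ} (hf : Measurable f) :
    ∫ t, f t ∂((ν.withDensity fun x => ENNReal.ofReal (g x)).map v) =
      ∫ x, f (v x) * g x ∂ν := by
  rw [integral_map (hv.mono_ac (withDensity_absolutelyContinuous _ _)) hf.aestronglyMeasurable,
    integral_withDensity_eq_integral_toReal_smul₀ hg.ennreal_ofReal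
      (Eventually.of_forall fun x => ENNReal.ofReal_lt_top)]
  refine integral_congr_ae ?_
  filter_upwards [hg0] with x hx
  rw [ENNReal.toReal_ofReal hx, smul_eq_mul, mul_comm]

end Pushforward

/-- The densities `b_{*u} + k` and `b + k` have the same image under `u_*` and `u` respectively. The
shift by `k` makes them nonnegative, so that both images are measures. -/
theorem map_withDensity_relRearr (hA : NullMeasurableSet A) (hAf : volume A ≠ ∞)
    (hu : AEMeasurable u (volume.restrict A)) (hb : AEMeasurable b (volume.restrict A)) {k C : ℝ}
    (hk : 0 ≤ k) (hC : 0 ≤ C) (hbd : ∀ᵐ x ∂volume.restrict A, b x ∈ Icc (-k) C) :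
    ((volume.restrict (Ioo 0 (volume.real A))).withDensity
        fun s => ENNReal.ofReal (relRearr A u b s + k)).map (decRearr A u) =
      ((volume.restrict A).withDensity fun x => ENNReal.ofReal (b x + k)).map u := by
  have : IsFiniteMeasure (volume.restrict A) := isFiniteMeasure_restrict.2 hAf
  have hbi := integrable_of_ae_mem_Icc hb hbd
  have hmem : ∀ᵐ s ∂volume.restrict (Ioo 0 (volume.real A)), relRearr A u b s ∈ Icc (-k) C := by
    filter_upwards [ae_restrict_mem measurableSet_Ioo] with s hs
    exact relRearr_mem_Icc hA hAf hu hb hbd (neg_nonpos.2 hk) hC hs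
  have hri := integrable_of_ae_mem_Icc measurable_relRearr.aemeasurable hmem
  have hm := aemeasurable_decRearr hA hAf hu
  have : IsFiniteMeasure ((volume.restrict (Ioo 0 (volume.real A))).withDensity
      fun s => ENNReal.ofReal (relRearr A u b s + k)) :=
    isFiniteMeasure_withDensity_ofReal (hri.add (integrable_const k)).2
  refine ext_of_tails _ _ fun q => ?_
  rw [map_withDensity_apply_Ioi (g := fun s => relRearr A u b s + k) hm
      (hri.add (integrable_const k)) (hmem.mono fun s hs => by linarith [hs.1]),
    map_withDensity_apply_Ioi (g := fun x => b x + k) hu (hbi.add (integrable_const k))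
      (hbd.mono fun s hs => by linarith [hs.1])]
  congr 1
  rw [integral_add hri.restrict (integrable_const k), integral_add hbi.restrict
    (integrable_const k), Measure.restrict_restrict₀
    (hm.nullMeasurableSet_preimage measurableSet_Ioi), preimage_decRearr_Ioi hA hAf hu,
    integral_relRearr_distributionFun hA hAf hu hb hbd]
  have h0 := distributionFun_nonneg (A := A) (u := u) q
  have hD := distributionFun_eq hA hu q
  rw [Measure.real, Measure.map_apply_of_aemeasurable hu measurableSet_Ioi] at hD
  simp [Measure.real, hD]

section ChangeOfVariables

variable (hA : NullMeasurableSet A) (hAf : volume A ≠ ∞)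
    (hu : AEMeasurable u (volume.restrict A)) (hb : AEMeasurable b (volume.restrict A)) {k C : ℝ}
    (hk : 0 ≤ k) (hC : 0 ≤ C) (hbd : ∀ᵐ x ∂volume.restrict A, b x ∈ Icc (-k) C)
    {f : ℝ → ℝ} (hf : Measurable f)

include hA hAf hu hb hk hC hbd hf

/-- No bound on `f` is needed here: both sides say that `f` is integrable for the same measure on
the line. -/
theorem integrableOn_comp_mul_relRearr_add_iff :
    IntegrableOn (fun s => f (decRearr A u s) * (relRearr A u b s + k))
      (Ioo 0 (volume.real A)) ↔ IntegrableOn (fun x => f (u x) * (b x + k)) A := by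
  rw [IntegrableOn, IntegrableOn,
    ← integrable_map_withDensity_iff hu (hb.add_const k)
      (hbd.mono fun s hs => by linarith [hs.1]) hf,
    ← integrable_map_withDensity_iff (aemeasurable_decRearr hA hAf hu)
      (measurable_relRearr.aemeasurable.add_const k) ?_ hf,
    map_withDensity_relRearr hA hAf hu hb hk hC hbd]
  filter_upwards [ae_restrict_mem measurableSet_Ioo] with s hs
  linarith [(relRearr_mem_Icc hA hAf hu hb hbd (neg_nonpos.2 hk) hC hs).1]

theorem integral_comp_mul_relRearr_add :
    ∫ s in Ioo 0 (volume.real A), f (decRearr A u s) * (relRearr A u b s + k) =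
      ∫ x in A, f (u x) * (b x + k) := by
  rw [← integral_map_withDensity hu (hb.add_const k)
      (hbd.mono fun s hs => by linarith [hs.1]) hf,
    ← integral_map_withDensity (aemeasurable_decRearr hA hAf hu)
      (measurable_relRearr.aemeasurable.add_const k) ?_ hf,
    map_withDensity_relRearr hA hAf hu hb hk hC hbd]
  filter_upwards [ae_restrict_mem measurableSet_Ioo] with s hs
  linarith [(relRearr_mem_Icc hA hAf hu hb hbd (neg_nonpos.2 hk) hC hs).1]

/-- For bounded `f` the shift `k` cancels, since `u` and `u_*` are equidistributed. -/
theorem integral_comp_mul_relRearr {M : ℝ} (hfM : ∀ t, |f t| ≤ M) :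
    ∫ x in A, f (u x) * b x =
      ∫ s in Ioo 0 (volume.real A), f (decRearr A u s) * relRearr A u b s := by
  have : IsFiniteMeasure (volume.restrict A) := isFiniteMeasure_restrict.2 hAf
  have hm := aemeasurable_decRearr hA hAf hu
  have hbi := integrable_of_ae_mem_Icc hb hbd
  have hri : Integrable (relRearr A u b) (volume.restrict (Ioo 0 (volume.real A))) := by
    refine integrable_of_ae_mem_Icc measurable_relRearr.aemeasurable (c := -k) (C := C) ?_
    filter_upwards [ae_restrict_mem measurableSet_Ioo] with s hs
    exact relRearr_mem_Icc hA hAf hu hb hbd (neg_nonpos.2 hk) hC hs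
  have h1 := hbi.bdd_mul (hf.comp_aemeasurable hu).aestronglyMeasurable
    (Eventually.of_forall fun x => hfM (u x))
  have h2 := hri.bdd_mul (hf.comp_aemeasurable hm).aestronglyMeasurable
    (Eventually.of_forall fun x => hfM (decRearr A u x))
  have h3 : Integrable (fun x => f (u x) * k) (volume.restrict A) :=
    (Integrable.of_bound (hf.comp_aemeasurable hu).aestronglyMeasurable M
      (Eventually.of_forall fun x => hfM (u x))).mul_const k
  have h4 : Integrable (fun s => f (decRearr A u s) * k)
      (volume.restrict (Ioo 0 (volume.real A))) :=
    (Integrable.of_bound (hf.comp_aemeasurable hm).aestronglyMeasurable M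
      (Eventually.of_forall fun x => hfM (decRearr A u x))).mul_const k
  have hk' : ∫ s in Ioo 0 (volume.real A), f (decRearr A u s) * k = ∫ x in A, f (u x) * k := by
    rw [← integral_map hm (f := fun t => f t * k) (hf.mul_const k).aestronglyMeasurable,
      ← integral_map hu (f := fun t => f t * k) (hf.mul_const k).aestronglyMeasurable,
      map_decRearr hA hAf hu]
  have h := integral_comp_mul_relRearr_add hA hAf hu hb hk hC hbd hf
  simp only [mul_add] at h
  have e1 := integral_add h1 h3
  have e2 := integral_add h2 h4
  simp only [Function.comp] at e1 e2
  linarith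

end ChangeOfVariables

theorem ae_mem_Icc_of_memLp_top {β : Type*} [MeasurableSpace β] {μ : Measure β} {b : β → ℝ}
    (hb : MemLp b ∞ μ) : ∃ M : ℝ, 0 ≤ M ∧ ∀ᵐ x ∂μ, b x ∈ Icc (-M) M := by
  refine ⟨(eLpNorm b ∞ μ).toReal, ENNReal.toReal_nonneg, ?_⟩
  filter_upwards [ae_le_eLpNormEssSup (f := b) (μ := μ)] with x hx
  rw [← eLpNorm_exponent_top] at hx
  have := ENNReal.toReal_mono hb.2.ne hx
  rw [toReal_enorm] at this
  exact abs_le.1 this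

end NonlocalFilter

/-! ### The filter and its rearranged form -/

theorem theorem1 {d : ℕ} (hd : 1 ≤ d) (Ω : Set (EuclideanSpace ℝ (Fin d)))
    (hΩo : IsOpen Ω) (hΩb : Bornology.IsBounded Ω)
    (h : ℝ) (hh : 0 < h)
    (K : ℝ → ℝ) (hKm : Measurable K) (hK : MemLp K ∞ volume) (hK0 : ∀ᵐ ξ, 0 ≤ K ξ)
    (w : EuclideanSpace ℝ (Fin d) → EuclideanSpace ℝ (Fin d) → ℝ)
    (hw : MemLp (fun p : EuclideanSpace ℝ (Fin d) × EuclideanSpace ℝ (Fin d) => w p.1 p.2) ∞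
      ((volume.restrict Ω).prod (volume.restrict Ω)))
    (hw0 : ∀ᵐ p ∂((volume.restrict Ω).prod (volume.restrict Ω)), 0 ≤ w p.1 p.2)
    (u : EuclideanSpace ℝ (Fin d) → ℝ) (hu : MemLp u ∞ (volume.restrict Ω))
    (hu0 : ∀ᵐ x ∂(volume.restrict Ω), 0 ≤ u x) :
    -- the relative rearrangement is well defined, and the integral identity holds
    (∀ b : EuclideanSpace ℝ (Fin d) → ℝ, MemLp b ∞ (volume.restrict Ω) →
      (∃ L : ℝ≥0, LipschitzOnWith L (NonlocalFilter.relPrimitive Ω u b)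
        (Ioo 0 (volume.real Ω))) ∧
      MemLp (NonlocalFilter.relRearr Ω u b) ∞ (volume.restrict (Ioo 0 (volume.real Ω))) ∧
      ∀ f : ℝ → ℝ, Measurable f → (∃ M : ℝ, ∀ t, |f t| ≤ M) →
        IntegrableOn (fun y => f (u y) * b y) Ω ∧
        IntegrableOn (fun s => f (NonlocalFilter.decRearr Ω u s) * NonlocalFilter.relRearr Ω u b s)
          (Ioo 0 (volume.real Ω)) ∧
        ∫ y in Ω, f (u y) * b y =
          ∫ s in Ioo 0 (volume.real Ω),
            f (NonlocalFilter.decRearr Ω u s) * NonlocalFilter.relRearr Ω u b s) ∧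
    -- the filter and its rearranged version agree: numerators, denominators and quotients
    ∀ᵐ x ∂(volume.restrict Ω),
      MemLp (w x) ∞ (volume.restrict Ω) ∧
      (IntegrableOn (NonlocalFilter.filterIntegrand K h w u x) Ω ↔
        IntegrableOn (NonlocalFilter.filterIntegrandStar Ω K h w u x)
          (Ioo 0 (volume.real Ω))) ∧
      (IntegrableOn (NonlocalFilter.normIntegrand K h w u x) Ω ↔
        IntegrableOn (NonlocalFilter.normIntegrandStar Ω K h w u x)
          (Ioo 0 (volume.real Ω))) ∧
      ((∃ M : ℝ, ∀ ξ, |K ξ| ≤ M) →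
        IntegrableOn (NonlocalFilter.filterIntegrand K h w u x) Ω ∧
        IntegrableOn (NonlocalFilter.normIntegrand K h w u x) Ω) ∧
      ∫ s in Ioo 0 (volume.real Ω), NonlocalFilter.filterIntegrandStar Ω K h w u x s =
        ∫ y in Ω, NonlocalFilter.filterIntegrand K h w u x y ∧
      ∫ s in Ioo 0 (volume.real Ω), NonlocalFilter.normIntegrandStar Ω K h w u x s =
        ∫ y in Ω, NonlocalFilter.normIntegrand K h w u x y ∧
      NonlocalFilter.rearrangedFilter Ω K h w u x = NonlocalFilter.nonlocalFilter Ω K h w u x := by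
  have hΩ : NullMeasurableSet Ω := hΩo.measurableSet.nullMeasurableSet
  have hΩf : volume Ω ≠ ∞ := hΩb.measure_lt_top.ne
  have : IsFiniteMeasure (volume.restrict Ω) := isFiniteMeasure_restrict.2 hΩf
  have hum := hu.1.aemeasurable
  constructor
  · intro b hb
    obtain ⟨M, hM0, hM⟩ := NonlocalFilter.ae_mem_Icc_of_memLp_top hb
    have hbm := hb.1.aemeasurable
    have hr : MemLp (NonlocalFilter.relRearr Ω u b) ∞
        (volume.restrict (Ioo 0 (volume.real Ω))) := by
      refine memLp_top_of_bound
        NonlocalFilter.measurable_relRearr.aestronglyMeasurable M ?_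
      filter_upwards [ae_restrict_mem measurableSet_Ioo] with s hs
      exact abs_le.2 (NonlocalFilter.relRearr_mem_Icc hΩ hΩf hum hbm hM (neg_nonpos.2 hM0) hM0 hs)
    refine ⟨⟨_, NonlocalFilter.lipschitzOnWith_of_sub_mem_Icc fun s hs t ht hst =>
      NonlocalFilter.relPrimitive_sub_mem_Icc hΩ hΩf hum hbm hM hs ht hst⟩, hr, ?_⟩
    rintro f hf ⟨N, hN⟩
    refine ⟨?_, ?_, NonlocalFilter.integral_comp_mul_relRearr hΩ hΩf hum hbm hM0 hM0 hM hf hN⟩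
    · exact (hb.integrable le_top).bdd_mul (hf.comp_aemeasurable hum).aestronglyMeasurable
        (Filter.Eventually.of_forall fun x => hN (u x))
    · exact (hr.integrable le_top).bdd_mul (hf.comp_aemeasurable
        (NonlocalFilter.aemeasurable_decRearr hΩ hΩf hum)).aestronglyMeasurable
        (Filter.Eventually.of_forall fun s => hN (NonlocalFilter.decRearr Ω u s))
  · obtain ⟨M, hM0, hM⟩ := NonlocalFilter.ae_mem_Icc_of_memLp_top hw
    filter_upwards [hw.1.prodMk_left, Measure.ae_ae_of_ae_prod hM,
      Measure.ae_ae_of_ae_prod hw0] with x hxm hxM hx0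
    have hwx : MemLp (w x) ∞ (volume.restrict Ω) :=
      memLp_top_of_bound hxm M (hxM.mono fun y hy => abs_le.2 hy)
    -- Nonnegativity of `w x` allows the shift `0` in the change of variables, which then holds
    -- for all Borel functions, bounded or not.
    have hbd : ∀ᵐ y ∂volume.restrict Ω, w x y ∈ Icc (-0) M := by
      filter_upwards [hxM, hx0] with y hy hy0
      exact ⟨by simpa using hy0, hy.2⟩
    have hKx : Measurable fun t => NonlocalFilter.scaledKernel K h (u x - t) :=
      hKm.comp ((measurable_const.sub measurable_id).div_const h)
    have hKx' : Measurable fun t => NonlocalFilter.scaledKernel K h (u x - t) * t :=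
      hKx.mul measurable_id
    have hfil : NonlocalFilter.filterIntegrand K h w u x =
        fun y => NonlocalFilter.scaledKernel K h (u x - u y) * u y * (w x y + 0) := by
      ext y; simp only [NonlocalFilter.filterIntegrand]; ring
    have hnor : NonlocalFilter.normIntegrand K h w u x =
        fun y => NonlocalFilter.scaledKernel K h (u x - u y) * (w x y + 0) := by
      ext y; simp only [NonlocalFilter.normIntegrand]; ring
    have hfilS : NonlocalFilter.filterIntegrandStar Ω K h w u x =
        fun s => NonlocalFilter.scaledKernel K h (u x - NonlocalFilter.decRearr Ω u s) *
          NonlocalFilter.decRearr Ω u s * (NonlocalFilter.relRearr Ω u (w x) s + 0) := by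
      ext s; simp only [NonlocalFilter.filterIntegrandStar]; ring
    have hnorS : NonlocalFilter.normIntegrandStar Ω K h w u x =
        fun s => NonlocalFilter.scaledKernel K h (u x - NonlocalFilter.decRearr Ω u s) *
          (NonlocalFilter.relRearr Ω u (w x) s + 0) := by
      ext s; simp only [NonlocalFilter.normIntegrandStar]; ring
    have hnum : ∫ s in Ioo 0 (volume.real Ω), NonlocalFilter.filterIntegrandStar Ω K h w u x s =
        ∫ y in Ω, NonlocalFilter.filterIntegrand K h w u x y := by
      rw [hfil, hfilS]
      exact NonlocalFilter.integral_comp_mul_relRearr_add hΩ hΩf hum hxm.aemeasurable le_rfl hM0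
        hbd hKx'
    have hden : ∫ s in Ioo 0 (volume.real Ω), NonlocalFilter.normIntegrandStar Ω K h w u x s =
        ∫ y in Ω, NonlocalFilter.normIntegrand K h w u x y := by
      rw [hnor, hnorS]
      exact NonlocalFilter.integral_comp_mul_relRearr_add hΩ hΩf hum hxm.aemeasurable le_rfl hM0
        hbd hKx
    refine ⟨hwx, ?_, ?_, ?_, hnum, hden, ?_⟩
    · rw [hfil, hfilS]
      exact (NonlocalFilter.integrableOn_comp_mul_relRearr_add_iff hΩ hΩf hum hxm.aemeasurable
        le_rfl hM0 hbd hKx').symm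
    · rw [hnor, hnorS]
      exact (NonlocalFilter.integrableOn_comp_mul_relRearr_add_iff hΩ hΩf hum hxm.aemeasurable
        le_rfl hM0 hbd hKx).symm
    · rintro ⟨N, hN⟩
      have hden' : IntegrableOn (NonlocalFilter.normIntegrand K h w u x) Ω :=
        (hwx.integrable le_top).bdd_mul (hKx.comp_aemeasurable hum).aestronglyMeasurable
          (Filter.Eventually.of_forall fun y => hN _)
      obtain ⟨R, -, hR⟩ := NonlocalFilter.ae_mem_Icc_of_memLp_top hu
      exact ⟨hden'.mul_bdd hu.1 (hR.mono fun y hy => abs_le.2 hy), hden'⟩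
    · rw [NonlocalFilter.rearrangedFilter, NonlocalFilter.nonlocalFilter, hnum, hden,
        one_div_mul_eq_div]
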